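/- Conventions. Rings are unital and need not be commutative. A Sylvester matrix rank function on a ring $R$ is an $\mathbb{R}_{\ge 0}$-valued function $\mathrm{rk}$ on the set of rectangular matrices over $R$ such that $\mathrm{rk}(0)=0$, $\mathrm{rk}(1_R)=1$, $\mathrm{rk}(AB)\le\min(\mathrm{rk}(A),\mathrm{rk}(B))$, $\mathrm{rk}\begin{bmatrix}A&0\\0&B\end{bmatrix}=\mathrm{rk}(A)+\mathrm{rk}(B)$ and $\mathrm{rk}\begin{bmatrix}A&C\\0&B\end{bmatrix}\ge \mathrm{rk}(A)+\mathrm{rk}(B)$. Let $E/K$ be an algebraic field extension, let $R$ be a $K$-algebra with a Sylvester matrix rank function $\mathrm{rk}$, and put $S=E\otimes_K R$, a left $R$-module by left multiplication by $1\otimes r$ for $r\in R$. Write $\dim(\mathcal W)$ for the rank of a finitely generated free left $R$-module $\mathcal W$ (this is well defined, since $\mathrm{rk}$ exists). The function $\mathrm{rk}_{\mathcal F}$. Let $\mathcal F$ be the set of left $R$-submodules $V\otimes_K R$ of $S$, for $V$ a finite-dimensional $K$-linear subspace of $E$, and let $\hat{\mathcal F}$ be the set of its nonzero members. For $\mathcal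 W\in\hat{\mathcal F}$ and $A\in M_{n,m}(S)$, choose $\tilde{\mathcal W}\in\hat{\mathcal F}$ with $\mathcal W A_{ij}\subseteq\tilde{\mathcal W}$ for all $i,j$, an $R$-basis $w_1,\dots,w_l$ of $\mathcal W^n$ and an $R$-basis $\tilde w_1,\dots,\tilde w_p$ of $\tilde{\mathcal W}^m$ (row vectors), and define $B\in M_{l,p}(R)$ by $w_iA=\sum_j B_{ij}\tilde w_j$; put $\mathrm{rk}_{\mathcal W}(A)=\mathrm{rk}(B)$. For a finite set $V\subseteq S$ and $\varepsilon>0$, call $\mathcal W\in\hat{\mathcal F}$ $(V,\varepsilon)$-invariant if some $\tilde{\mathcal W}\in\mathcal F$ contains $\mathcal W+\mathcal WV$ and has $\dim(\tilde{\mathcal W})\le(1+\varepsilon)\dim(\mathcal W)$. Call an ultrafilter $\omega$ on $\hat{\mathcal F}$ non-principal if for every finite $V\subseteq S$ and every $\varepsilon>0$ it contains the set of $(V,\varepsilon)$-invariant members of $\hat{\mathcal F}$. For such $\omega$ put $$\mathrm{rk}_{\mathcal F}(A)=\lim_{\mathcal W\to\omega}\frac{\mathrm{rk}_{\mathcal W}(A)}{\dim(\mathcal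 W)}.$$ Jaikin-Zapirain's extension. For $A\in M_{n,m}(S)$ choose a finite subextension $E_0/K$ of $E/K$ with $A\in M_{n,m}(E_0\otimes_K R)$, an $R$-basis $w_1,\dots,w_l$ of $(E_0\otimes_K R)^n$ and an $R$-basis $\tilde w_1,\dots,\tilde w_p$ of $(E_0\otimes_K R)^m$, define $B\in M_{l,p}(R)$ by $w_iA=\sum_j B_{ij}\tilde w_j$, and put $$\mathrm{rk}_{E\otimes_K R}(A)=\frac{\mathrm{rk}(B)}{\dim_K(E_0)}.$$ Proposition 9.2. These notions are well defined: (a) $S$ is a right amenable extension of $R$ with finite approximation system $\mathcal F$; that is, the members of $\mathcal F$ are finitely generated free, $\mathcal F$ is closed under $\cap$ and $+$, whenever $\mathcal V\subseteq\mathcal W$ in $\mathcal F$ one has $\mathcal W=\mathcal V\oplus\mathcal V'$ for some $\mathcal V'\in\mathcal F$, every finitely generated left $R$-submodule of $S$ is contained in a member of $\mathcal F$, and for every finite $V\subseteq S$ and $\varepsilon>0$ there is a $(V,\varepsilon)$-invariant $\mathcal W\in\hat{\mathcal F}$; (b) non-principal ultrafilters on $\hat{\mathcal F}$ exist; (c)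 the choices in the definitions of $\mathrm{rk}_{\mathcal W}(A)$ and of $\mathrm{rk}_{E\otimes_K R}(A)$ can be made, and these numbers do not depend on them. Moreover, for every non-principal ultrafilter $\omega$ on $\hat{\mathcal F}$, the limit defining $\mathrm{rk}_{\mathcal F}$ exists and $$\mathrm{rk}_{\mathcal F}=\mathrm{rk}_{E\otimes_K R},$$ that is, $\mathrm{rk}_{\mathcal F}(A)=\mathrm{rk}_{E\otimes_K R}(A)$ for all $n,m$ and all $A\in M_{n,m}(E\otimes_K R)$. -/

import Mathlib

open Filter Topology
open scoped TensorProduct Matrix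

/-- A Sylvester matrix rank function on a unital ring `R`: a nonnegative real function on all
rectangular matrices over `R` with the four axioms of Malcolmson. -/
structure SylvesterMatrixRank (R : Type*) [Ring R] where
  rank : ∀ {n m : ℕ}, Matrix (Fin n) (Fin m) R → ℝ
  rank_nonneg : ∀ {n m : ℕ} (A : Matrix (Fin n) (Fin m) R), 0 ≤ rank A
  rank_zero : ∀ n m : ℕ, rank (0 : Matrix (Fin n) (Fin m) R) = 0
  rank_one : rank (1 : Matrix (Fin 1) (Fin 1) R) = 1
  rank_mul_le : ∀ {n m l : ℕ} (A : Matrix (Fin n) (Fin m) R) (B : Matrix (Fin m) (Fin l) R),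
    rank (A * B) ≤ min (rank A) (rank B)
  rank_diag : ∀ {n m k l : ℕ} (A : Matrix (Fin n) (Fin m) R) (B : Matrix (Fin k) (Fin l) R),
    rank (Matrix.reindex finSumFinEquiv finSumFinEquiv (Matrix.fromBlocks A 0 0 B)) =
      rank A + rank B
  rank_upper : ∀ {n m k l : ℕ} (A : Matrix (Fin n) (Fin m) R) (B : Matrix (Fin k) (Fin l) R)
    (C : Matrix (Fin n) (Fin l) R),
    rank A + rank B ≤
      rank (Matrix.reindex finSumFinEquiv finSumFinEquiv (Matrix.fromBlocks A C 0 B))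

/-! ### Right amenable extensions

In this section `S` is a ring containing `R`, viewed as a left `R`-module by left multiplication,
and `F` is a collection of left `R`-submodules of `S`. -/

section Amenable

variable {R S : Type*} [Ring R] [Ring S] [Module R S]

/-- The rank of a finitely generated free left `R`-module `M`: the number `d` with `M ≅ R ^ d`.
It is unique if `R` has invariant basis number, as every ring with a Sylvester matrix rank function
does. (`Module.finrank` is a different number in general: it is the supremum of the cardinalities
of linearly independent families, and a free algebra contains infinite ones.) -/
noncomputable def freeDim (R : Type*) [Ring R] (M : Type*) [AddCommGroup M] [Module R M] : ℕ :=
  sInf {d : ℕ | Nonempty (M ≃ₗ[R] (Fin d → R))}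

/-- `F` is a finite approximation system for `S`. -/
structure IsFiniteApproximationSystem (F : Set (Submodule R S)) : Prop where
  free : ∀ W ∈ F, ∃ d : ℕ, Nonempty (W ≃ₗ[R] (Fin d → R))
  inf_mem : ∀ W ∈ F, ∀ V ∈ F, W ⊓ V ∈ F
  sup_mem : ∀ W ∈ F, ∀ V ∈ F, W ⊔ V ∈ F
  exists_compl : ∀ W ∈ F, ∀ V ∈ F, V ≤ W → ∃ V' ∈ F, V ⊓ V' = ⊥ ∧ V ⊔ V' = W
  exists_ge : ∀ M : Submodule R S, M.FG → ∃ W ∈ F, M ≤ W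

/-- The nonzero elements of `F`. -/
abbrev NonzeroMembers (F : Set (Submodule R S)) : Type _ := {W : Submodule R S // W ∈ F ∧ W ≠ ⊥}

/-- `W` is `(V, ε)`-invariant: some member of `F` contains `W + W V` and has rank at most
`(1 + ε) dim W`. -/
def IsInvariantMember (F : Set (Submodule R S)) (V : Set S) (ε : ℝ) (W : NonzeroMembers F) : Prop :=
  ∃ W' ∈ F, W.1 ≤ W' ∧ (∀ w ∈ W.1, ∀ v ∈ V, w * v ∈ W') ∧
    (freeDim R W' : ℝ) ≤ (1 + ε) * freeDim R W.1

/-- `S` is a right amenable extension of `R` with finite approximation system `F`. -/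
structure IsRightAmenableExtension (F : Set (Submodule R S)) : Prop
    extends IsFiniteApproximationSystem F where
  exists_invariant : ∀ V : Set S, V.Finite → ∀ ε : ℝ, 0 < ε →
    ∃ W : NonzeroMembers F, IsInvariantMember F V ε W

/-- `r` is a value of `rk_W(A)`: one has `r = rk B`, where `W'` is a nonzero member of `F` with
`W A_{ij} ⊆ W'` for all `i, j`, and `B` expresses the vectors `w_i A`, for an `R`-basis `w` of
`W ^ n`, through an `R`-basis `w'` of `W' ^ m`. -/
def IsLocalRankValue (rk : SylvesterMatrixRank R) (F : Set (Submodule R S)) (W : NonzeroMembers F)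
    {n m : ℕ} (A : Matrix (Fin n) (Fin m) S) (r : ℝ) : Prop :=
  ∃ W' : NonzeroMembers F, (∀ i j, ∀ x ∈ W.1, x * A i j ∈ W'.1) ∧
    ∃ (l p : ℕ) (w : Module.Basis (Fin l) R (Fin n → W.1))
      (w' : Module.Basis (Fin p) R (Fin m → W'.1)) (B : Matrix (Fin l) (Fin p) R),
      (∀ i, (fun k => (w i k : S)) ᵥ* A = ∑ j, B i j • (fun k => (w' j k : S))) ∧ r = rk.rank B

/-- The number `rk_W(A)`. -/
noncomputable def localRank (rk : SylvesterMatrixRank R) (F : Set (Submodule R S))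
    (W : NonzeroMembers F) {n m : ℕ} (A : Matrix (Fin n) (Fin m) S) : ℝ :=
  Classical.epsilon (IsLocalRankValue rk F W A)

/-- An ultrafilter on the nonzero members of `F` is non-principal if it contains the set of
`(V, ε)`-invariant members for all finite `V ⊆ S` and `ε > 0`. -/
def IsNonprincipal (F : Set (Submodule R S)) (ω : Ultrafilter (NonzeroMembers F)) : Prop :=
  ∀ V : Set S, V.Finite → ∀ ε : ℝ, 0 < ε → {W | IsInvariantMember F V ε W} ∈ ω

/-- The rank function `rk_F` on matrices over `S`: the limit of `rk_W(A) / dim W` along `ω`. -/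
noncomputable def amenableRank (rk : SylvesterMatrixRank R) (F : Set (Submodule R S))
    (ω : Ultrafilter (NonzeroMembers F)) {n m : ℕ} (A : Matrix (Fin n) (Fin m) S) : ℝ :=
  limUnder (ω : Filter (NonzeroMembers F)) fun W => localRank rk F W A / (freeDim R W.1 : ℝ)

end Amenable

/-! ### Extension of scalars -/

section FieldExtension

variable (K E R : Type*) [Field K] [Field E] [Algebra K E] [Ring R] [Algebra K R]

/-- `E ⊗ R` as a left `R`-module: `r` acts as left multiplication by `1 ⊗ r`. -/
noncomputable abbrev tensorLeftModule : Module R (E ⊗[K] R) :=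
  Module.compHom (E ⊗[K] R)
    (Algebra.TensorProduct.includeRight : R →ₐ[K] E ⊗[K] R).toRingHom

attribute [local instance] tensorLeftModule

theorem tensorLeftModule_smul (r : R) (x : E ⊗[K] R) : r • x = ((1 : E) ⊗ₜ[K] r) * x := rfl

/-- The collection of the left `R`-submodules `V ⊗ R` of `E ⊗ R`, for `V` a finite-dimensional
`K`-subspace of `E`. -/
def tensorSystem : Set (Submodule R (E ⊗[K] R)) :=
  {W | ∃ V : Submodule K E, FiniteDimensional K V ∧
    W = Submodule.span R {x | ∃ v ∈ V, ∃ r : R, x = v ⊗ₜ[K] r}}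

variable {K E R}

/-- `r` is a value of Jaikin-Zapirain's extension of `rk` at `A`: one has `r = rk B / dim_K E₀`,
where `E₀` is a finite subextension such that `A` comes from a matrix `A₀` over `E₀ ⊗ R`, and `B`
expresses the vectors `w_i A₀`, for an `R`-basis `w` of `(E₀ ⊗ R) ^ n`, through an `R`-basis `w'`
of `(E₀ ⊗ R) ^ m`. -/
def IsAlgebraicRankValue (rk : SylvesterMatrixRank R) {n m : ℕ}
    (A : Matrix (Fin n) (Fin m) (E ⊗[K] R)) (r : ℝ) : Prop :=
  ∃ E₀ : IntermediateField K E, FiniteDimensional K E₀ ∧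
    ∃ A₀ : Matrix (Fin n) (Fin m) (E₀ ⊗[K] R),
      A = A₀.map (Algebra.TensorProduct.map E₀.val (AlgHom.id K R)) ∧
      ∃ (l p : ℕ) (w : Module.Basis (Fin l) R (Fin n → E₀ ⊗[K] R))
        (w' : Module.Basis (Fin p) R (Fin m → E₀ ⊗[K] R)) (B : Matrix (Fin l) (Fin p) R),
        (∀ i, w i ᵥ* A₀ = ∑ j, B i j • w' j) ∧ r = rk.rank B / (Module.finrank K E₀ : ℝ)

/-- Jaikin-Zapirain's extension of `rk` to matrices over `E ⊗ R`, for `E` algebraic over `K`. -/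
noncomputable def algebraicRank (rk : SylvesterMatrixRank R) {n m : ℕ}
    (A : Matrix (Fin n) (Fin m) (E ⊗[K] R)) : ℝ :=
  Classical.epsilon (IsAlgebraicRankValue rk A)

end FieldExtension

attribute [local instance] tensorLeftModule

/-!
Both rank functions are computed from ranks of `R`-linear maps between finitely generated free
modules. Such a rank (`SylvesterMatrixRank.linRank`) does not depend on bases, does not increase
under composition, and is additive on direct sums and subadditive on sums of maps. Applied to
identity maps, it shows that `R` has invariant basis number.

The submodules `V ⊗ R` of `E ⊗ R` are controlled by the slice maps `E ⊗ R → E` coming from linear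
forms on `R`: an element lies in `V ⊗ R` exactly when its slices lie in `V`
(`mem_tensorSubmodule_iff`). Hence `V ↦ V ⊗ R` respects inclusions, intersections and sums, and
`V ⊗ R` is free of rank `dim V`, which gives the approximation system. Every finite subset of
`E ⊗ R` lies in the subring `E₀ ⊗ R` for some finite subextension `E₀`, and this is an exactly
invariant member of the system. The number `rk_W(A)` does not depend on the target, because two
targets are direct summands of their sum (`linRank_rowMulMap_eq`).

For the comparison, let `A` come from a matrix over `E₀ ⊗ R`, and let `α` be the value of
Jaikin-Zapirain's extension that is computed with `E₀`. If `W = V ⊗ R` is `ε`-invariant under a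
basis of `E₀`, then the `E₀`-space `U` spanned by `V` satisfies
`dim V ≤ dim U ≤ (1 + ε) dim V`. A basis of `U` over `E₀` splits `U ⊗ R` into copies of `E₀ ⊗ R`
that right multiplication by `A` preserves, so the rank on `U ⊗ R` is exactly `α dim U`
(`linRank_rowMulMap_tensorSubmodule`). Passing from `U` to the summand `V` changes the rank by at
most `n ε dim V` (`localRank_bounds`). Therefore `rk_W(A) / dim W` tends to `α` along every
non-principal ultrafilter (`IsAlgebraicRankValue.tendsto`). Since such ultrafilters exist and limits
are unique, this also shows that `α` does not depend on `E₀`.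
-/

/-! ### Ranks of linear maps between free modules -/

section LinearRank

variable {R : Type*} [Ring R]

/-- The matrix of a linear map between free left modules, in the row convention: the `i`-th row
holds the coordinates of the image of the `i`-th basis vector, so that `f` followed by `g` has
the product of the matrices of `f` and `g`, in this order. -/
noncomputable def rowMatrix {M N : Type*} [AddCommGroup M] [Module R M] [AddCommGroup N]
    [Module R N] {ι κ : Type*} (b : Module.Basis ι R M) (c : Module.Basis κ R N) (f : M →ₗ[R] N) :
    Matrix ι κ R :=
  Matrix.of fun i j => c.repr (f (b i)) j

variable {M N P M' N' : Type*} [AddCommGroup M] [Module R M] [AddCommGroup N] [Module R N]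
  [AddCommGroup P] [Module R P] [AddCommGroup M'] [Module R M'] [AddCommGroup N'] [Module R N']

theorem rowMatrix_comp {ι κ μ : Type*} [Fintype κ] (b : Module.Basis ι R M)
    (c : Module.Basis κ R N) (d : Module.Basis μ R P) (f : M →ₗ[R] N) (g : N →ₗ[R] P) :
    rowMatrix b d (g ∘ₗ f) = rowMatrix b c f * rowMatrix c d g := by
  ext i j
  have h : g (f (b i)) = ∑ k, c.repr (f (b i)) k • g (c k) := by
    conv_lhs => rw [← c.sum_repr (f (b i)), map_sum]
    simp only [map_smul]
  simp [rowMatrix, Matrix.mul_apply, h, Finsupp.finsetSum_apply]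

theorem rowMatrix_id {ι : Type*} [DecidableEq ι] (b : Module.Basis ι R M) :
    rowMatrix b b LinearMap.id = 1 := by
  ext i j
  simp [rowMatrix, Matrix.one_apply, Finsupp.single_apply]

theorem rowMatrix_eq_iff {ι κ : Type*} [Fintype κ] (b : Module.Basis ι R M)
    (c : Module.Basis κ R N) (f : M →ₗ[R] N) (B : Matrix ι κ R) :
    B = rowMatrix b c f ↔ ∀ i, f (b i) = ∑ j, B i j • c j := by
  constructor
  · rintro rfl i
    exact (c.sum_repr _).symm
  · intro h
    ext i j
    rw [rowMatrix, Matrix.of_apply, h i, c.repr_sum_self]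

theorem rowMatrix_prodMap {a b c d : ℕ} (u : Module.Basis (Fin a) R M)
    (v : Module.Basis (Fin b) R N) (u' : Module.Basis (Fin c) R M')
    (v' : Module.Basis (Fin d) R N') (f : M →ₗ[R] N) (g : M' →ₗ[R] N') :
    rowMatrix ((u.prod u').reindex finSumFinEquiv) ((v.prod v').reindex finSumFinEquiv)
        (f.prodMap g) =
      Matrix.reindex finSumFinEquiv finSumFinEquiv
        (Matrix.fromBlocks (rowMatrix u v f) 0 0 (rowMatrix u' v' g)) := by
  ext i j
  obtain ⟨i, rfl⟩ := finSumFinEquiv.surjective i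
  obtain ⟨j, rfl⟩ := finSumFinEquiv.surjective j
  rcases i with i | i <;> rcases j with j | j <;> simp [rowMatrix]

/-- A basis of a finitely generated free module that is indexed by an initial segment of `ℕ`. -/
noncomputable def freeBasis (R M : Type*) [Ring R] [AddCommGroup M] [Module R M]
    [Module.Free R M] [Module.Finite R M] :
    Module.Basis (Fin (Fintype.card (Module.Free.ChooseBasisIndex R M))) R M :=
  (Module.Free.chooseBasis R M).reindex (Fintype.equivFin _)

namespace SylvesterMatrixRank

variable (rk : SylvesterMatrixRank R)

theorem rank_one_fin (d : ℕ) : rk.rank (1 : Matrix (Fin d) (Fin d) R) = d := by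
  induction d with
  | zero => simpa [Subsingleton.elim (1 : Matrix (Fin 0) (Fin 0) R) 0] using rk.rank_zero 0 0
  | succ d ih =>
    have h := rk.rank_diag (1 : Matrix (Fin d) (Fin d) R) (1 : Matrix (Fin 1) (Fin 1) R)
    rw [Matrix.fromBlocks_one, ih, rk.rank_one] at h
    simpa using h

/-- Over the zero ring, `rk 0 = 0` and `rk 1 = 1` contradict each other. -/
theorem nontrivial (rk : SylvesterMatrixRank R) : Nontrivial R := by
  by_contra h
  rw [not_nontrivial_iff_subsingleton] at h
  have h1 := rk.rank_one
  rw [Subsingleton.elim (1 : Matrix (Fin 1) (Fin 1) R) 0, rk.rank_zero] at h1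
  exact zero_ne_one h1

variable [Module.Free R M] [Module.Finite R M] [Module.Free R N] [Module.Finite R N]
  [Module.Free R P] [Module.Finite R P] [Module.Free R M'] [Module.Finite R M']
  [Module.Free R N'] [Module.Finite R N']

/-- The rank of a linear map between finitely generated free left modules: the rank of its matrix
in any bases (see `rank_rowMatrix`). -/
noncomputable def linRank (f : M →ₗ[R] N) : ℝ :=
  rk.rank (rowMatrix (freeBasis R M) (freeBasis R N) f)

theorem rank_rowMatrix {a b : ℕ} (u : Module.Basis (Fin a) R M) (v : Module.Basis (Fin b) R N)
    (f : M →ₗ[R] N) : rk.rank (rowMatrix u v f) = rk.linRank f := by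
  have key : ∀ {a b c d : ℕ} (u : Module.Basis (Fin a) R M) (v : Module.Basis (Fin b) R N)
      (u' : Module.Basis (Fin c) R M) (v' : Module.Basis (Fin d) R N),
      rk.rank (rowMatrix u v f) ≤ rk.rank (rowMatrix u' v' f) := by
    intro a b c d u v u' v'
    have h : rowMatrix u v f =
        rowMatrix u u' LinearMap.id * (rowMatrix u' v' f * rowMatrix v' v LinearMap.id) := by
      rw [← rowMatrix_comp, ← rowMatrix_comp, LinearMap.comp_id, LinearMap.id_comp]
    rw [h]
    exact ((rk.rank_mul_le _ _).trans (min_le_right _ _)).trans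
      ((rk.rank_mul_le _ _).trans (min_le_left _ _))
  exact le_antisymm (key ..) (key ..)

theorem linRank_nonneg (f : M →ₗ[R] N) : 0 ≤ rk.linRank f := rk.rank_nonneg _

theorem linRank_comp_le_left (g : N →ₗ[R] P) (f : M →ₗ[R] N) :
    rk.linRank (g ∘ₗ f) ≤ rk.linRank g := by
  rw [linRank, rowMatrix_comp _ (freeBasis R N)]
  exact (rk.rank_mul_le _ _).trans (min_le_right _ _)

theorem linRank_comp_le_right (g : N →ₗ[R] P) (f : M →ₗ[R] N) :
    rk.linRank (g ∘ₗ f) ≤ rk.linRank f := by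
  rw [linRank, rowMatrix_comp _ (freeBasis R N)]
  exact (rk.rank_mul_le _ _).trans (min_le_left _ _)

theorem linRank_prodMap (f : M →ₗ[R] N) (g : M' →ₗ[R] N') :
    rk.linRank (f.prodMap g) = rk.linRank f + rk.linRank g := by
  rw [← rk.rank_rowMatrix (((freeBasis R M).prod (freeBasis R M')).reindex finSumFinEquiv)
    (((freeBasis R N).prod (freeBasis R N')).reindex finSumFinEquiv), rowMatrix_prodMap,
    rk.rank_diag, linRank, linRank]

theorem linRank_add_le (f g : M →ₗ[R] N) : rk.linRank (f + g) ≤ rk.linRank f + rk.linRank g := by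
  -- `f + g` factors through `f ⊕ g`, by the diagonal and the addition map
  have h : f + g = (LinearMap.coprod LinearMap.id LinearMap.id ∘ₗ f.prodMap g) ∘ₗ
      LinearMap.prod LinearMap.id LinearMap.id := by
    ext x; simp
  rw [h, ← linRank_prodMap]
  exact (rk.linRank_comp_le_left _ _).trans (rk.linRank_comp_le_right _ _)

/-- The rank does not change under isomorphisms of the source and of the target. -/
theorem linRank_eq_of_equiv (e : M ≃ₗ[R] M') (e' : N ≃ₗ[R] N') (f : M →ₗ[R] N)
    (g : M' →ₗ[R] N') (h : ∀ x, e' (f x) = g (e x)) : rk.linRank f = rk.linRank g := by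
  apply le_antisymm
  · have : f = (e'.symm : N' →ₗ[R] N) ∘ₗ (g ∘ₗ (e : M →ₗ[R] M')) := by
      ext x; simp [← h]
    rw [this]
    exact (rk.linRank_comp_le_right _ _).trans (rk.linRank_comp_le_left _ _)
  · have : g = (e' : N →ₗ[R] N') ∘ₗ (f ∘ₗ (e.symm : M' →ₗ[R] M)) := by
      ext x; simp [h]
    rw [this]
    exact (rk.linRank_comp_le_right _ _).trans (rk.linRank_comp_le_left _ _)

theorem linRank_of_subsingleton [Subsingleton M] (f : M →ₗ[R] N) : rk.linRank f = 0 := by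
  have h : rowMatrix (freeBasis R M) (freeBasis R N) f = 0 := by
    ext i j
    simp [rowMatrix, Subsingleton.elim (freeBasis R M i) 0]
  rw [linRank, h, rk.rank_zero]

/-- The direct sum of `k` copies of `f` has `k` times the rank of `f`. -/
theorem linRank_compLeft (f : M →ₗ[R] N) (k : ℕ) :
    rk.linRank (f.compLeft (Fin k)) = k * rk.linRank f := by
  induction k with
  | zero => simp [linRank_of_subsingleton]
  | succ k ih =>
    rw [← rk.linRank_eq_of_equiv (Fin.consLinearEquiv R fun _ => M)
      (Fin.consLinearEquiv R fun _ => N) (f.prodMap (f.compLeft (Fin k))), linRank_prodMap, ih]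
    · push_cast; ring
    · intro x
      ext i
      refine Fin.cases ?_ (fun i => ?_) i <;> simp

theorem linRank_id_eq {d : ℕ} (b : Module.Basis (Fin d) R M) :
    rk.linRank (LinearMap.id : M →ₗ[R] M) = d := by
  rw [← rk.rank_rowMatrix b b, rowMatrix_id, rank_one_fin]

/-- The infimum in `freeDim` is over a single number: the rank of the identity determines the size
of a finite basis. -/
theorem freeDim_eq_linRank_id (rk : SylvesterMatrixRank R) (M : Type*) [AddCommGroup M]
    [Module R M] [Module.Free R M] [Module.Finite R M] :
    (freeDim R M : ℝ) = rk.linRank (LinearMap.id : M →ₗ[R] M) := by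
  have h : {d : ℕ | Nonempty (M ≃ₗ[R] (Fin d → R))} =
      {Fintype.card (Module.Free.ChooseBasisIndex R M)} := by
    ext d
    simp only [Set.mem_ofPred_eq, Set.mem_singleton_iff]
    constructor
    · rintro ⟨e⟩
      exact_mod_cast (rk.linRank_id_eq (Module.Basis.ofEquivFun e)).symm.trans
        (rk.linRank_id_eq (freeBasis R M))
    · rintro rfl
      exact ⟨(freeBasis R M).equivFun⟩
  rw [freeDim, h, csInf_singleton, rk.linRank_id_eq (freeBasis R M)]

theorem freeDim_eq (rk : SylvesterMatrixRank R) {d : ℕ} (b : Module.Basis (Fin d) R M) :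
    freeDim R M = d := by
  exact_mod_cast (rk.freeDim_eq_linRank_id M).trans (rk.linRank_id_eq b)

theorem freeDim_congr (rk : SylvesterMatrixRank R) (e : M ≃ₗ[R] N) : freeDim R M = freeDim R N := by
  have := rk.linRank_eq_of_equiv e e LinearMap.id LinearMap.id fun _ => rfl
  rw [← freeDim_eq_linRank_id, ← freeDim_eq_linRank_id] at this
  exact_mod_cast this

theorem freeDim_prod (rk : SylvesterMatrixRank R) :
    freeDim R (M × N) = freeDim R M + freeDim R N := by
  have := rk.linRank_prodMap (LinearMap.id : M →ₗ[R] M) (LinearMap.id : N →ₗ[R] N)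
  rw [LinearMap.prodMap_id, ← freeDim_eq_linRank_id, ← freeDim_eq_linRank_id,
    ← freeDim_eq_linRank_id] at this
  exact_mod_cast this

theorem freeDim_pi (rk : SylvesterMatrixRank R) (k : ℕ) :
    freeDim R (Fin k → M) = k * freeDim R M := by
  have := rk.linRank_compLeft (LinearMap.id : M →ₗ[R] M) k
  rw [show (LinearMap.id : M →ₗ[R] M).compLeft (Fin k) = LinearMap.id from rfl,
    ← freeDim_eq_linRank_id, ← freeDim_eq_linRank_id] at this
  exact_mod_cast this

/-- Restriction to a direct summand lowers the rank by at most the rank of a complement. -/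
theorem linRank_le_add_freeDim (f : M →ₗ[R] N) (i : M' →ₗ[R] M) (p : M →ₗ[R] M')
    (i' : N' →ₗ[R] M) (p' : M →ₗ[R] N') (h : ∀ x, i (p x) + i' (p' x) = x) :
    rk.linRank f ≤ rk.linRank (f ∘ₗ i) + freeDim R N' := by
  have hf : f = (f ∘ₗ i) ∘ₗ p + ((f ∘ₗ i') ∘ₗ LinearMap.id) ∘ₗ p' := by
    ext x
    simp [← map_add, h]
  conv_lhs => rw [hf]
  refine (rk.linRank_add_le _ _).trans (add_le_add (rk.linRank_comp_le_left _ _) ?_)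
  rw [freeDim_eq_linRank_id]
  exact (rk.linRank_comp_le_left _ _).trans (rk.linRank_comp_le_right _ _)

end SylvesterMatrixRank

end LinearRank

/-! ### Local ranks for a finite approximation system -/

section LocalRank

variable {R S : Type*} [Ring R] [Ring S] [Module R S]

namespace IsFiniteApproximationSystem

variable {F : Set (Submodule R S)}

theorem moduleFree (hF : IsFiniteApproximationSystem F) {W : Submodule R S} (hW : W ∈ F) :
    Module.Free R W := by
  obtain ⟨d, ⟨e⟩⟩ := hF.free W hW
  exact Module.Free.of_equiv e.symm

theorem moduleFinite (hF : IsFiniteApproximationSystem F) {W : Submodule R S} (hW : W ∈ F) :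
    Module.Finite R W := by
  obtain ⟨d, ⟨e⟩⟩ := hF.free W hW
  exact Module.Finite.equiv e.symm

/-- A member of the system is a direct summand of every larger member. -/
theorem exists_prod_equiv (hF : IsFiniteApproximationSystem F) {V W : Submodule R S} (hV : V ∈ F)
    (hW : W ∈ F) (h : V ≤ W) :
    ∃ V' ∈ F, ∃ e : (V × V') ≃ₗ[R] W, ∀ x, (e x : S) = x.1 + x.2 := by
  obtain ⟨V', hV', hinf, hsup⟩ := hF.exists_compl W hW V hV h
  have hle : V' ≤ W := hsup ▸ le_sup_right
  set f := (Submodule.inclusion h).coprod (Submodule.inclusion hle) with hf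
  have hfx : ∀ x, (f x : S) = x.1 + x.2 := fun x => by simp [hf]
  have hinj : Function.Injective f := by
    rw [injective_iff_map_eq_zero]
    rintro ⟨⟨x, hx⟩, ⟨y, hy⟩⟩ hxy
    have hxy' : x + y = 0 := (hfx _).symm.trans (congrArg Subtype.val hxy)
    have hmem : x ∈ V ⊓ V' := ⟨hx, by rw [eq_neg_of_add_eq_zero_left hxy']; exact neg_mem hy⟩
    rw [hinf, Submodule.mem_bot] at hmem
    subst hmem
    rw [zero_add] at hxy'
    subst hxy'
    rfl
  have hsurj : Function.Surjective f := by
    rintro ⟨z, hz⟩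
    rw [← hsup] at hz
    obtain ⟨x, hx, y, hy, rfl⟩ := Submodule.mem_sup.1 hz
    exact ⟨(⟨x, hx⟩, ⟨y, hy⟩), Subtype.ext (hfx _)⟩
  exact ⟨V', hV', LinearEquiv.ofBijective f ⟨hinj, hsurj⟩, hfx⟩

theorem freeDim_mono (hF : IsFiniteApproximationSystem F) (rk : SylvesterMatrixRank R)
    {V W : Submodule R S} (hV : V ∈ F) (hW : W ∈ F) (h : V ≤ W) : freeDim R V ≤ freeDim R W := by
  obtain ⟨V', hV', e, -⟩ := hF.exists_prod_equiv hV hW h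
  have := hF.moduleFree hV
  have := hF.moduleFinite hV
  have := hF.moduleFree hV'
  have := hF.moduleFinite hV'
  have := hF.moduleFree hW
  have := hF.moduleFinite hW
  rw [← rk.freeDim_congr e, rk.freeDim_prod]
  exact Nat.le_add_right _ _

theorem freeDim_pos (hF : IsFiniteApproximationSystem F) (rk : SylvesterMatrixRank R)
    (W : NonzeroMembers F) : 0 < freeDim R W.1 := by
  have := hF.moduleFree W.2.1
  have := hF.moduleFinite W.2.1
  refine Nat.pos_of_ne_zero fun h => W.2.2 ?_
  rw [rk.freeDim_eq (freeBasis R W.1)] at h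
  have : IsEmpty (Fin (Fintype.card (Module.Free.ChooseBasisIndex R W.1))) := by
    rw [h]
    infer_instance
  have := (freeBasis R W.1).equivFun.injective.subsingleton
  exact Submodule.eq_bot_of_subsingleton

end IsFiniteApproximationSystem

theorem IsInvariantMember.mono {F : Set (Submodule R S)} {V V' : Set S} {ε ε' : ℝ}
    {W : NonzeroMembers F} (h : IsInvariantMember F V ε W) (hV : V' ⊆ V) (hε : ε ≤ ε') :
    IsInvariantMember F V' ε' W := by
  obtain ⟨W', hW', hle, hmul, hdim⟩ := h
  exact ⟨W', hW', hle, fun w hw v hv => hmul w hw v (hV hv), hdim.trans (by gcongr)⟩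

/-- Choose a `(V, 1 / (k + 1))`-invariant member for each pair `(V, k)`, and push the filter `atTop`
on these pairs forward: any finer ultrafilter is non-principal. -/
theorem IsRightAmenableExtension.exists_isNonprincipal {F : Set (Submodule R S)}
    (hF : IsRightAmenableExtension F) : ∃ ω : Ultrafilter (NonzeroMembers F),
      IsNonprincipal F ω := by
  classical
  choose W hW using fun p : Finset S × ℕ =>
    hF.exists_invariant p.1 p.1.finite_toSet (1 / ((p.2 : ℝ) + 1)) Nat.one_div_pos_of_nat
  refine ⟨Ultrafilter.of (map W atTop), fun V hV ε hε => Ultrafilter.of_le _ ?_⟩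
  obtain ⟨k, hk⟩ := exists_nat_one_div_lt hε
  rw [mem_map]
  filter_upwards [eventually_ge_atTop (hV.toFinset, k)] with p hp
  refine (hW p).mono (fun v hv => hp.1 (by simpa using hv)) (le_trans ?_ hk.le)
  exact Nat.one_div_le_one_div hp.2

variable [IsScalarTower R S S] {n m : ℕ}

/-- Right multiplication of row vectors by a matrix `A` over `S`, as a map of left `R`-modules
`W ^ n → W' ^ m`. -/
def rowMulMap (W W' : Submodule R S) (A : Matrix (Fin n) (Fin m) S)
    (h : ∀ i j, ∀ x ∈ W, x * A i j ∈ W') : (Fin n → W) →ₗ[R] (Fin m → W') where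
  toFun v j := ⟨∑ i, (v i : S) * A i j, sum_mem fun i _ => h i j _ (v i).2⟩
  map_add' v w := by
    ext j
    simp [add_mul, Finset.sum_add_distrib]
  map_smul' r v := by
    ext j
    simp only [Pi.smul_apply, Submodule.coe_smul, RingHom.id_apply, Finset.smul_sum,
      ← smul_eq_mul, smul_assoc]

theorem coe_rowMulMap (W W' : Submodule R S) (A : Matrix (Fin n) (Fin m) S)
    (h : ∀ i j, ∀ x ∈ W, x * A i j ∈ W') (v : Fin n → W) :
    (fun j => (rowMulMap W W' A h v j : S)) = (fun i => (v i : S)) ᵥ* A := rfl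

variable (rk : SylvesterMatrixRank R) {F : Set (Submodule R S)}

/-- Enlarging the target keeps the rank, because the smaller target is a retract of the larger. -/
theorem linRank_rowMulMap_mono (hF : IsFiniteApproximationSystem F) {W W₁ W₂ : Submodule R S}
    (h₁ : W₁ ∈ F) (h₂ : W₂ ∈ F) (hle : W₁ ≤ W₂) (A : Matrix (Fin n) (Fin m) S)
    (h : ∀ i j, ∀ x ∈ W, x * A i j ∈ W₁) [Module.Free R W] [Module.Finite R W]
    [Module.Free R W₁] [Module.Finite R W₁] [Module.Free R W₂] [Module.Finite R W₂] :
    rk.linRank (rowMulMap W W₂ A fun i j x hx => hle (h i j x hx)) =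
      rk.linRank (rowMulMap W W₁ A h) := by
  obtain ⟨V', -, e, he⟩ := hF.exists_prod_equiv h₁ h₂ hle
  have hleft : rowMulMap W W₂ A (fun i j x hx => hle (h i j x hx)) =
      (Submodule.inclusion hle).compLeft (Fin m) ∘ₗ rowMulMap W W₁ A h := by
    ext; rfl
  have hright : rowMulMap W W₁ A h = (LinearMap.fst R W₁ V' ∘ₗ e.symm.toLinearMap).compLeft
      (Fin m) ∘ₗ rowMulMap W W₂ A (fun i j x hx => hle (h i j x hx)) := by
    have hfst : ∀ x : W₁, e.symm (Submodule.inclusion hle x) = (x, 0) := fun x => by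
      rw [LinearEquiv.symm_apply_eq]
      ext
      simp [he]
    rw [hleft]
    refine LinearMap.ext fun v => funext fun j => ?_
    simp [hfst]
  apply le_antisymm
  · rw [hleft]
    exact rk.linRank_comp_le_right _ _
  · conv_lhs => rw [hright]
    exact rk.linRank_comp_le_right _ _

/-- The rank of right multiplication by `A` on `W ^ n` does not depend on the member of `F` that
is used as target: two choices are direct summands of their sum. -/
theorem linRank_rowMulMap_eq (hF : IsFiniteApproximationSystem F) {W W₁ W₂ : Submodule R S}
    (h₁ : W₁ ∈ F) (h₂ : W₂ ∈ F) (A : Matrix (Fin n) (Fin m) S)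
    (hA₁ : ∀ i j, ∀ x ∈ W, x * A i j ∈ W₁) (hA₂ : ∀ i j, ∀ x ∈ W, x * A i j ∈ W₂)
    [Module.Free R W] [Module.Finite R W]
    [Module.Free R W₁] [Module.Finite R W₁] [Module.Free R W₂] [Module.Finite R W₂] :
    rk.linRank (rowMulMap W W₁ A hA₁) = rk.linRank (rowMulMap W W₂ A hA₂) := by
  have h := hF.sup_mem _ h₁ _ h₂
  have := hF.moduleFree h
  have := hF.moduleFinite h
  rw [← linRank_rowMulMap_mono rk hF h₁ h le_sup_left, ← linRank_rowMulMap_mono rk hF h₂ h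
    le_sup_right]

/-- The values of `rk_W(A)` are the ranks of right multiplication by `A`, and any one target `W'`
gives all of them. -/
theorem isLocalRankValue_iff (hF : IsFiniteApproximationSystem F) (W : NonzeroMembers F)
    {W' : Submodule R S} (hW' : W' ∈ F) (A : Matrix (Fin n) (Fin m) S)
    (hle : W.1 ≤ W') (hA : ∀ i j, ∀ x ∈ W.1, x * A i j ∈ W') [Module.Free R W.1]
    [Module.Finite R W.1] [Module.Free R W'] [Module.Finite R W'] (r : ℝ) :
    IsLocalRankValue rk F W A r ↔ r = rk.linRank (rowMulMap W.1 W' A hA) := by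
  constructor
  · rintro ⟨T, hT, l, p, w, w', B, hB, rfl⟩
    have := hF.moduleFree T.2.1
    have := hF.moduleFinite T.2.1
    rw [linRank_rowMulMap_eq rk hF hW' T.2.1 A hA hT, ← rk.rank_rowMatrix w w']
    congr 1
    rw [rowMatrix_eq_iff]
    intro i
    ext k
    have hk := congrFun (hB i) k
    rw [← coe_rowMulMap _ _ A hT] at hk
    simpa using hk
  · rintro rfl
    have hne : W' ≠ ⊥ := fun h => W.2.2 (eq_bot_iff.2 (h ▸ hle))
    refine ⟨⟨W', hW', hne⟩, hA, _, _, freeBasis R _, freeBasis R _, _, fun i => ?_, rfl⟩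
    rw [← coe_rowMulMap _ _ A hA]
    have := (rowMatrix_eq_iff (freeBasis R (Fin n → W.1)) (freeBasis R (Fin m → W'))
      (rowMulMap W.1 W' A hA) _).1 rfl i
    rw [this]
    ext k
    simp

theorem exists_mul_mem (hF : IsFiniteApproximationSystem F) (W : NonzeroMembers F)
    (A : Matrix (Fin n) (Fin m) S) :
    ∃ W' ∈ F, W.1 ≤ W' ∧ ∀ i j, ∀ x ∈ W.1, x * A i j ∈ W' := by
  have := hF.moduleFinite W.2.1
  have hfg : W.1.FG := Module.Finite.iff_fg.1 this
  obtain ⟨W', hW', hle⟩ := hF.exists_ge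
    (W.1 ⊔ ⨆ i, ⨆ j, W.1.map (LinearMap.toSpanSingleton S S (A i j) |>.restrictScalars R))
    (hfg.sup (Submodule.fg_iSup _ fun i => Submodule.fg_iSup _ fun j => hfg.map _))
  refine ⟨W', hW', le_sup_left.trans hle, fun i j x hx => hle (le_sup_right (a := W.1) ?_)⟩
  refine Submodule.mem_iSup_of_mem i (Submodule.mem_iSup_of_mem j ?_)
  exact ⟨x, hx, by simp⟩

theorem isLocalRankValue_iff_eq_localRank (hF : IsFiniteApproximationSystem F)
    (W : NonzeroMembers F) (A : Matrix (Fin n) (Fin m) S) (r : ℝ) :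
    IsLocalRankValue rk F W A r ↔ r = localRank rk F W A := by
  obtain ⟨W', hW', hle, hA⟩ := exists_mul_mem hF W A
  have := hF.moduleFree W.2.1
  have := hF.moduleFinite W.2.1
  have := hF.moduleFree hW'
  have := hF.moduleFinite hW'
  have key := isLocalRankValue_iff rk hF W hW' A hle hA
  have hloc : IsLocalRankValue rk F W A (localRank rk F W A) :=
    Classical.epsilon_spec (p := IsLocalRankValue rk F W A) ⟨_, (key _).2 rfl⟩
  rw [key, ← (key _).1 hloc]

theorem localRank_eq_linRank (hF : IsFiniteApproximationSystem F) (W : NonzeroMembers F)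
    {W' : Submodule R S} (hW' : W' ∈ F) (A : Matrix (Fin n) (Fin m) S)
    (hle : W.1 ≤ W') (hA : ∀ i j, ∀ x ∈ W.1, x * A i j ∈ W') [Module.Free R W.1]
    [Module.Finite R W.1] [Module.Free R W'] [Module.Finite R W'] :
    localRank rk F W A = rk.linRank (rowMulMap W.1 W' A hA) :=
  ((isLocalRankValue_iff_eq_localRank rk hF W A _).1
    ((isLocalRankValue_iff rk hF W hW' A hle hA _).2 rfl)).symm

/-- If `U ⊇ W` is stable under the entries of `A`, then `rk_W(A)` differs from the rank of right
multiplication by `A` on `U ^ n` by at most `n (dim U - dim W)`. -/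
theorem localRank_bounds (hF : IsFiniteApproximationSystem F) (W : NonzeroMembers F)
    {U : Submodule R S} (hU : U ∈ F) (A : Matrix (Fin n) (Fin m) S)
    (hle : W.1 ≤ U) (hA : ∀ i j, ∀ x ∈ U, x * A i j ∈ U) [Module.Free R U]
    [Module.Finite R U] :
    localRank rk F W A ≤ rk.linRank (rowMulMap U U A hA) ∧
      rk.linRank (rowMulMap U U A hA) ≤
        localRank rk F W A + n * ((freeDim R U : ℝ) - freeDim R W.1) := by
  have := hF.moduleFree W.2.1
  have := hF.moduleFinite W.2.1
  have hA' : ∀ i j, ∀ x ∈ W.1, x * A i j ∈ U := fun i j x hx => hA i j x (hle hx)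
  have hcomp : rowMulMap W.1 U A hA' =
      rowMulMap U U A hA ∘ₗ (Submodule.inclusion hle).compLeft (Fin n) := by
    ext; rfl
  rw [localRank_eq_linRank rk hF W hU A hle hA', hcomp]
  refine ⟨rk.linRank_comp_le_left _ _, ?_⟩
  obtain ⟨C, hC, e, he⟩ := hF.exists_prod_equiv W.2.1 hU hle
  have := hF.moduleFree hC
  have := hF.moduleFinite hC
  have hCU : C ≤ U := fun c hc => by simpa [he] using (e (0, ⟨c, hc⟩)).2
  have hdim : (n : ℝ) * ((freeDim R U : ℝ) - freeDim R W.1) = freeDim R (Fin n → C) := by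
    rw [rk.freeDim_pi, ← rk.freeDim_congr e, rk.freeDim_prod]
    push_cast
    ring
  rw [hdim]
  refine rk.linRank_le_add_freeDim _ _
    ((LinearMap.fst R W.1 C ∘ₗ e.symm.toLinearMap).compLeft (Fin n))
    ((Submodule.inclusion hCU).compLeft (Fin n))
    ((LinearMap.snd R W.1 C ∘ₗ e.symm.toLinearMap).compLeft (Fin n)) fun x => ?_
  ext k
  have := he (e.symm (x k))
  simpa using this.symm

end LocalRank

/-! ### Slices and the submodules `V ⊗ R` -/

section Slice

variable {K E R : Type*} [Field K] [Field E] [Algebra K E] [Ring R] [Algebra K R]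

instance tensorLeftModule_isScalarTower : IsScalarTower R (E ⊗[K] R) (E ⊗[K] R) :=
  ⟨fun r x y => mul_assoc ((1 : E) ⊗ₜ[K] r) x y⟩

theorem smul_tmul_right (r s : R) (v : E) : r • (v ⊗ₜ[K] s : E ⊗[K] R) = v ⊗ₜ[K] (r * s) := by
  rw [tensorLeftModule_smul, Algebra.TensorProduct.tmul_mul_tmul, one_mul]

/-- The slice map `E ⊗ R → E` of a linear form `φ` on `R`, which sends `v ⊗ r` to `φ r • v`. -/
noncomputable def slice (φ : Module.Dual K R) : E ⊗[K] R →ₗ[K] E :=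
  TensorProduct.lift (LinearMap.mk₂ K (fun v r => φ r • v) (fun _ _ _ => smul_add _ _ _)
    (fun _ _ _ => smul_comm _ _ _) (fun _ _ _ => by rw [map_add, add_smul])
    (fun _ _ _ => by rw [map_smul, smul_assoc]))

@[simp]
theorem slice_tmul (φ : Module.Dual K R) (v : E) (r : R) : slice φ (v ⊗ₜ[K] r) = φ r • v := rfl

theorem equivFinsuppOfBasisRight_eq_slice {ι : Type*} [DecidableEq ι] (b : Module.Basis ι K R)
    (x : E ⊗[K] R) (i : ι) :
    TensorProduct.equivFinsuppOfBasisRight b x i = slice (b.coord i) x := by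
  induction x with
  | zero => simp
  | tmul v r => simp
  | add x y hx hy => simp only [map_add, Finsupp.add_apply, hx, hy]

theorem slice_smul (φ : Module.Dual K R) (r : R) (x : E ⊗[K] R) :
    slice φ (r • x) = slice (φ ∘ₗ LinearMap.mulLeft K r) x := by
  induction x with
  | zero => simp
  | tmul v s => simp [smul_tmul_right]
  | add x y hx hy => simp only [smul_add, map_add, hx, hy]

theorem slice_tmul_one_mul (φ : Module.Dual K R) (u : E) (x : E ⊗[K] R) :
    slice φ ((u ⊗ₜ[K] (1 : R)) * x) = u * slice φ x := by
  induction x with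
  | zero => simp
  | tmul v s => simp
  | add x y hx hy => simp only [mul_add, map_add, hx, hy]

/-- The left `R`-submodule `V ⊗ R` of `E ⊗ R`. -/
noncomputable def tensorSubmodule (R : Type*) [Ring R] [Algebra K R] (V : Submodule K E) :
    Submodule R (E ⊗[K] R) :=
  Submodule.span R {x | ∃ v ∈ V, ∃ r : R, x = v ⊗ₜ[K] r}

theorem tmul_mem_tensorSubmodule {V : Submodule K E} {v : E} (hv : v ∈ V) (r : R) :
    v ⊗ₜ[K] r ∈ tensorSubmodule R V :=
  Submodule.subset_span ⟨v, hv, r, rfl⟩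

/-- An element of `E ⊗ R` lies in `V ⊗ R` if and only if all of its slices lie in `V`. This
reduces questions on the submodules `V ⊗ R` to linear algebra in `E`. -/
theorem mem_tensorSubmodule_iff {V : Submodule K E} {x : E ⊗[K] R} :
    x ∈ tensorSubmodule R V ↔ ∀ φ : Module.Dual K R, slice φ x ∈ V := by
  classical
  constructor
  · intro hx
    induction hx using Submodule.span_induction with
    | mem x hx =>
      obtain ⟨v, hv, r, rfl⟩ := hx
      intro φ
      rw [slice_tmul]
      exact V.smul_mem _ hv
    | zero => simp
    | add x y _ _ hx hy => exact fun φ => by rw [map_add]; exact add_mem (hx φ) (hy φ)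
    | smul r x _ hx => exact fun φ => by rw [slice_smul]; exact hx _
  · intro h
    let b := Module.Basis.ofVectorSpace K R
    have hx := (TensorProduct.equivFinsuppOfBasisRight (M := E) b).symm_apply_apply x
    rw [TensorProduct.equivFinsuppOfBasisRight_symm_apply] at hx
    rw [← hx]
    refine sum_mem fun i _ => tmul_mem_tensorSubmodule ?_ _
    rw [equivFinsuppOfBasisRight_eq_slice]
    exact h (b.coord i)

/-- Slices separate the points of `E ⊗ R`, which proves the injectivity claims below. -/
theorem eq_zero_of_slice_eq_zero {x : E ⊗[K] R} (h : ∀ φ : Module.Dual K R, slice φ x = 0) :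
    x = 0 := by
  classical
  let b := Module.Basis.ofVectorSpace K R
  refine (LinearEquiv.map_eq_zero_iff (TensorProduct.equivFinsuppOfBasisRight (M := E) b)).1 ?_
  ext i
  rw [equivFinsuppOfBasisRight_eq_slice]
  exact h _

theorem tmul_one_mem_tensorSubmodule_iff [Nontrivial R] {V : Submodule K E} {v : E} :
    v ⊗ₜ[K] (1 : R) ∈ tensorSubmodule R V ↔ v ∈ V := by
  refine ⟨fun h => ?_, fun h => tmul_mem_tensorSubmodule h 1⟩
  -- a slice with `φ 1 ≠ 0` recovers `v` up to a nonzero scalar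
  obtain ⟨φ, hφ⟩ : ∃ φ : Module.Dual K R, φ 1 ≠ 0 := by
    by_contra! hφ
    exact one_ne_zero ((Module.forall_dual_apply_eq_zero_iff K (1 : R)).1 hφ)
  have := mem_tensorSubmodule_iff.1 h φ
  rwa [slice_tmul, Submodule.smul_mem_iff _ hφ] at this

theorem tensorSubmodule_mono {V W : Submodule K E} (h : V ≤ W) :
    tensorSubmodule R V ≤ tensorSubmodule R W :=
  fun _ hx => mem_tensorSubmodule_iff.2 fun φ => h (mem_tensorSubmodule_iff.1 hx φ)

theorem tensorSubmodule_le_iff [Nontrivial R] {V W : Submodule K E} :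
    tensorSubmodule R V ≤ tensorSubmodule R W ↔ V ≤ W :=
  ⟨fun h _ hv => tmul_one_mem_tensorSubmodule_iff.1 (h (tmul_mem_tensorSubmodule hv (1 : R))),
    tensorSubmodule_mono⟩

theorem tensorSubmodule_bot : tensorSubmodule R (⊥ : Submodule K E) = ⊥ := by
  rw [eq_bot_iff]
  exact fun x hx => (Submodule.mem_bot R).2 (eq_zero_of_slice_eq_zero fun φ =>
    (Submodule.mem_bot K).1 (mem_tensorSubmodule_iff.1 hx φ))

theorem tensorSubmodule_top : tensorSubmodule R (⊤ : Submodule K E) = ⊤ :=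
  eq_top_iff.2 fun _ _ => mem_tensorSubmodule_iff.2 fun _ => trivial

theorem tensorSubmodule_inf (V W : Submodule K E) :
    tensorSubmodule R (V ⊓ W) = tensorSubmodule R V ⊓ tensorSubmodule R W := by
  ext x
  simp only [Submodule.mem_inf, mem_tensorSubmodule_iff, forall_and]

theorem tensorSubmodule_sup (V W : Submodule K E) :
    tensorSubmodule R (V ⊔ W) = tensorSubmodule R V ⊔ tensorSubmodule R W := by
  refine le_antisymm (Submodule.span_le.2 ?_)
    (sup_le (tensorSubmodule_mono le_sup_left) (tensorSubmodule_mono le_sup_right))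
  rintro _ ⟨_, hv, r, rfl⟩
  obtain ⟨a, ha, b, hb, rfl⟩ := Submodule.mem_sup.1 hv
  rw [TensorProduct.add_tmul]
  exact Submodule.add_mem_sup (tmul_mem_tensorSubmodule ha r) (tmul_mem_tensorSubmodule hb r)

/-- A `K`-basis `u` of `V` gives the `R`-basis `u ⊗ 1` of `V ⊗ R`. -/
theorem exists_basis_tensorSubmodule (R : Type*) [Ring R] [Algebra K R] (V : Submodule K E)
    [FiniteDimensional K V] :
    Nonempty (Module.Basis (Fin (Module.finrank K V)) R (tensorSubmodule R V)) := by
  let u := Module.finBasis K V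
  let f : (Fin (Module.finrank K V) → R) →ₗ[R] E ⊗[K] R :=
    { toFun := fun y => ∑ a, (u a : E) ⊗ₜ[K] y a
      map_add' := fun y z => by simp [TensorProduct.tmul_add, Finset.sum_add_distrib]
      map_smul' := fun r y => by simp [Finset.smul_sum, smul_tmul_right] }
  have hf : ∀ y, f y = ∑ a, (u a : E) ⊗ₜ[K] y a := fun _ => rfl
  have hu : LinearIndependent K fun a => (u a : E) :=
    u.linearIndependent.map' V.subtype V.ker_subtype
  have hinj : Function.Injective f := by
    rw [injective_iff_map_eq_zero]
    intro y hy
    funext a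
    refine (Module.forall_dual_apply_eq_zero_iff K (y a)).1 fun φ => ?_
    have h := congrArg (slice φ) hy
    simp only [hf, map_sum, slice_tmul, map_zero] at h
    exact Fintype.linearIndependent_iff.1 hu _ h a
  have hrange : LinearMap.range f = tensorSubmodule R V := by
    apply le_antisymm
    · rintro _ ⟨y, rfl⟩
      rw [hf]
      exact sum_mem fun a _ => tmul_mem_tensorSubmodule (u a).2 _
    · refine Submodule.span_le.2 ?_
      rintro _ ⟨v, hv, r, rfl⟩
      refine ⟨fun a => u.repr ⟨v, hv⟩ a • r, ?_⟩
      have h := congrArg Subtype.val (u.sum_repr ⟨v, hv⟩)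
      rw [Submodule.coe_sum] at h
      rw [hf]
      conv_rhs => rw [show v = _ from h.symm, TensorProduct.sum_tmul]
      simp [TensorProduct.smul_tmul]
  exact ⟨Module.Basis.ofEquivFun
    ((LinearEquiv.ofInjective f hinj).trans (LinearEquiv.ofEq _ _ hrange)).symm⟩

theorem exists_basis_tensor (K E R : Type*) [Field K] [Field E] [Algebra K E] [Ring R]
    [Algebra K R] [FiniteDimensional K E] :
    Nonempty (Module.Basis (Fin (Module.finrank K E)) R (E ⊗[K] R)) := by
  obtain ⟨b⟩ := exists_basis_tensorSubmodule R (⊤ : Submodule K E)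
  exact ⟨(b.reindex (finCongr (finrank_top K E))).map
    ((LinearEquiv.ofEq _ _ tensorSubmodule_top).trans Submodule.topEquiv)⟩

theorem exists_finiteDimensional_subset_tensorSubmodule {T : Set (E ⊗[K] R)} (hT : T.Finite) :
    ∃ V : Submodule K E, FiniteDimensional K V ∧ T ⊆ tensorSubmodule R V := by
  induction T, hT using Set.Finite.induction_on with
  | empty => exact ⟨⊥, inferInstance, Set.empty_subset _⟩
  | @insert x T hxT _ ih =>
    clear hxT
    obtain ⟨V, hV, hTV⟩ := ih
    obtain ⟨W, hW, hxW⟩ : ∃ W : Submodule K E, FiniteDimensional K W ∧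
        x ∈ tensorSubmodule R W := by
      induction x with
      | zero => exact ⟨⊥, inferInstance, zero_mem _⟩
      | tmul v r => exact ⟨Submodule.span K {v}, inferInstance,
          tmul_mem_tensorSubmodule (Submodule.mem_span_singleton_self v) r⟩
      | add x y hx hy =>
        obtain ⟨W₁, h₁, hx⟩ := hx
        obtain ⟨W₂, h₂, hy⟩ := hy
        exact ⟨W₁ ⊔ W₂, inferInstance, add_mem (tensorSubmodule_mono le_sup_left hx)
          (tensorSubmodule_mono le_sup_right hy)⟩
    refine ⟨V ⊔ W, inferInstance, Set.insert_subset (tensorSubmodule_mono le_sup_right hxW) ?_⟩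
    exact hTV.trans (tensorSubmodule_mono le_sup_left)

theorem isFiniteApproximationSystem_tensorSystem [Nontrivial R] :
    IsFiniteApproximationSystem (tensorSystem K E R) where
  free := by
    rintro _ ⟨V, hV, rfl⟩
    obtain ⟨b⟩ := exists_basis_tensorSubmodule R V
    exact ⟨_, ⟨b.equivFun⟩⟩
  inf_mem := by
    rintro _ ⟨V, hV, rfl⟩ _ ⟨W, hW, rfl⟩
    exact ⟨V ⊓ W, Submodule.finiteDimensional_inf_left V W, (tensorSubmodule_inf V W).symm⟩
  sup_mem := by
    rintro _ ⟨V, hV, rfl⟩ _ ⟨W, hW, rfl⟩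
    exact ⟨V ⊔ W, inferInstance, (tensorSubmodule_sup V W).symm⟩
  exists_compl := by
    rintro _ ⟨W, hW, rfl⟩ _ ⟨V, hV, rfl⟩ hle
    have hVW : V ≤ W := (tensorSubmodule_le_iff (R := R)).1 hle
    -- the complement of `V` in `W` is cut out by a complement `C` in all of `E`
    obtain ⟨C, hC⟩ := Submodule.exists_isCompl V
    refine ⟨tensorSubmodule R (W ⊓ C), ⟨W ⊓ C, Submodule.finiteDimensional_inf_left W C, rfl⟩,
      (tensorSubmodule_inf V (W ⊓ C)).symm.trans ?_,
      (tensorSubmodule_sup V (W ⊓ C)).symm.trans ?_⟩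
    · rw [inf_left_comm, hC.inf_eq_bot, inf_bot_eq, tensorSubmodule_bot]
    · rw [inf_comm, ← sup_inf_assoc_of_le C hVW, hC.sup_eq_top, top_inf_eq]
      rfl
  exists_ge := by
    rintro _ ⟨T, rfl⟩
    obtain ⟨V, hV, hT⟩ := exists_finiteDimensional_subset_tensorSubmodule T.finite_toSet
    exact ⟨tensorSubmodule R V, ⟨V, hV, rfl⟩, Submodule.span_le.2 hT⟩

end Slice

/-! ### Finite subextensions -/

section Subextension

variable {K E R : Type*} [Field K] [Field E] [Algebra K E] [Ring R] [Algebra K R]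

/-- The map `E₀ ⊗ R → E ⊗ R` of a subextension `E₀`, as a map of left `R`-modules. -/
noncomputable def tensorInclusion (R : Type*) [Ring R] [Algebra K R] (E₀ : IntermediateField K E) :
    E₀ ⊗[K] R →ₗ[R] E ⊗[K] R where
  toFun := Algebra.TensorProduct.map E₀.val (AlgHom.id K R)
  map_add' := map_add _
  map_smul' r x := by
    simp [tensorLeftModule_smul]

theorem tensorInclusion_tmul (E₀ : IntermediateField K E) (e : E₀) (r : R) :
    tensorInclusion R E₀ (e ⊗ₜ[K] r) = (e : E) ⊗ₜ[K] r := rfl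

theorem tensorInclusion_mul (E₀ : IntermediateField K E) (x y : E₀ ⊗[K] R) :
    tensorInclusion R E₀ (x * y) = tensorInclusion R E₀ x * tensorInclusion R E₀ y :=
  map_mul (Algebra.TensorProduct.map E₀.val (AlgHom.id K R)) x y

theorem slice_tensorInclusion (E₀ : IntermediateField K E) (φ : Module.Dual K R)
    (x : E₀ ⊗[K] R) : slice φ (tensorInclusion R E₀ x) = (slice φ x : E₀) := by
  induction x with
  | zero => simp
  | tmul e r => simp [tensorInclusion_tmul]
  | add x y hx hy => simp only [map_add, hx, hy, IntermediateField.coe_add]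

/-- The image of `E₀ ⊗ R` in `E ⊗ R` is the member of the system given by `V = E₀`. -/
theorem range_tensorInclusion (E₀ : IntermediateField K E) :
    LinearMap.range (tensorInclusion R E₀) = tensorSubmodule R E₀.toSubalgebra.toSubmodule := by
  apply le_antisymm
  · rintro _ ⟨x, rfl⟩
    rw [mem_tensorSubmodule_iff]
    intro φ
    rw [slice_tensorInclusion]
    exact (slice φ x).2
  · refine Submodule.span_le.2 ?_
    rintro _ ⟨v, hv, r, rfl⟩
    exact ⟨(⟨v, hv⟩ : E₀) ⊗ₜ[K] r, rfl⟩

theorem exists_intermediateField_subset_range [Algebra.IsAlgebraic K E] {T : Set (E ⊗[K] R)}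
    (hT : T.Finite) : ∃ E₀ : IntermediateField K E, FiniteDimensional K E₀ ∧
      T ⊆ Set.range (tensorInclusion R E₀) := by
  obtain ⟨V, hV, hTV⟩ := exists_finiteDimensional_subset_tensorSubmodule hT
  obtain ⟨s, rfl⟩ := Module.Finite.iff_fg.1 hV
  refine ⟨IntermediateField.adjoin K (s : Set E), ?_, ?_⟩
  · exact IntermediateField.finiteDimensional_adjoin fun x _ =>
      (Algebra.IsAlgebraic.isAlgebraic x).isIntegral
  · rw [← LinearMap.coe_range, range_tensorInclusion]
    refine hTV.trans (tensorSubmodule_mono (Submodule.span_le.2 ?_))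
    exact IntermediateField.subset_adjoin K _

theorem isRightAmenableExtension_tensorSystem [Nontrivial R] [Algebra.IsAlgebraic K E] :
    IsRightAmenableExtension (tensorSystem K E R) where
  toIsFiniteApproximationSystem := isFiniteApproximationSystem_tensorSystem
  exists_invariant := by
    intro T hT ε hε
    obtain ⟨E₀, hE₀, hTE⟩ := exists_intermediateField_subset_range hT
    have hmem : LinearMap.range (tensorInclusion R E₀) ∈ tensorSystem K E R :=
      ⟨E₀.toSubalgebra.toSubmodule, hE₀, range_tensorInclusion E₀⟩
    have hne : LinearMap.range (tensorInclusion R E₀) ≠ ⊥ := by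
      rw [range_tensorInclusion, ← tensorSubmodule_bot]
      intro h
      have h1 : E₀.toSubalgebra.toSubmodule ≤ ⊥ := (tensorSubmodule_le_iff (R := R)).1 h.le
      exact one_ne_zero ((Submodule.mem_bot K).1 (h1 (one_mem E₀)))
    refine ⟨⟨_, hmem, hne⟩, _, hmem, le_rfl, ?_, ?_⟩
    · rintro _ ⟨x, rfl⟩ t ht
      obtain ⟨y, rfl⟩ := hTE ht
      exact ⟨x * y, tensorInclusion_mul E₀ x y⟩
    · exact le_mul_of_one_le_left (Nat.cast_nonneg _) (by linarith)

/-- If `U` is an `E₀`-subspace of `E`, then an `E₀`-basis `u` of `U` splits `U ⊗ R` into copies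
`u a ⊗ 1 * (E₀ ⊗ R)` of `E₀ ⊗ R`. -/
theorem exists_equiv_tensorSubmodule (R : Type*) [Ring R] [Algebra K R]
    (E₀ : IntermediateField K E) (U : Submodule E₀ E) {k : ℕ} (u : Module.Basis (Fin k) E₀ U) :
    ∃ e : (Fin k → E₀ ⊗[K] R) ≃ₗ[R] tensorSubmodule R (U.restrictScalars K),
      ∀ x, (e x : E ⊗[K] R) = ∑ a, ((u a : E) ⊗ₜ[K] (1 : R)) * tensorInclusion R E₀ (x a) := by
  have hcomm : ∀ (v : E) (r : R) (y : E ⊗[K] R),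
      (v ⊗ₜ[K] (1 : R)) * (r • y) = r • ((v ⊗ₜ[K] (1 : R)) * y) := by
    intro v r y
    simp only [tensorLeftModule_smul, ← mul_assoc, Algebra.TensorProduct.tmul_mul_tmul, mul_one,
      one_mul]
  let f : (Fin k → E₀ ⊗[K] R) →ₗ[R] E ⊗[K] R :=
    { toFun := fun x => ∑ a, ((u a : E) ⊗ₜ[K] (1 : R)) * tensorInclusion R E₀ (x a)
      map_add' := fun x y => by simp [mul_add, Finset.sum_add_distrib]
      map_smul' := fun r x => by simp [Finset.smul_sum, hcomm] }
  have hf : ∀ x, f x = ∑ a, ((u a : E) ⊗ₜ[K] (1 : R)) * tensorInclusion R E₀ (x a) :=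
    fun _ => rfl
  have hslice : ∀ (φ : Module.Dual K R) x,
      slice φ (f x) = ∑ a, (slice φ (x a) : E₀) • (u a : E) := by
    intro φ x
    rw [hf, map_sum]
    refine Finset.sum_congr rfl fun a _ => ?_
    rw [slice_tmul_one_mul, slice_tensorInclusion, mul_comm]
    rfl
  have hu : LinearIndependent E₀ fun a => (u a : E) :=
    u.linearIndependent.map' U.subtype U.ker_subtype
  have hinj : Function.Injective f := by
    rw [injective_iff_map_eq_zero]
    intro x hx
    funext a
    refine eq_zero_of_slice_eq_zero fun φ => ?_
    have h := hslice φ x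
    rw [hx, map_zero] at h
    exact Fintype.linearIndependent_iff.1 hu _ h.symm a
  have hrange : LinearMap.range f = tensorSubmodule R (U.restrictScalars K) := by
    apply le_antisymm
    · rintro _ ⟨x, rfl⟩
      rw [mem_tensorSubmodule_iff]
      intro φ
      rw [hslice]
      exact sum_mem fun a _ => U.smul_mem _ (u a).2
    · refine Submodule.span_le.2 ?_
      rintro _ ⟨v, hv, r, rfl⟩
      refine ⟨fun a => u.repr ⟨v, hv⟩ a ⊗ₜ[K] r, ?_⟩
      have h := congrArg Subtype.val (u.sum_repr ⟨v, hv⟩)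
      rw [Submodule.coe_sum] at h
      rw [hf]
      conv_rhs => rw [show v = _ from h.symm, TensorProduct.sum_tmul]
      refine Finset.sum_congr rfl fun a _ => ?_
      rw [tensorInclusion_tmul, Algebra.TensorProduct.tmul_mul_tmul, one_mul, mul_comm]
      rfl
  exact ⟨(LinearEquiv.ofInjective f hinj).trans (LinearEquiv.ofEq _ _ hrange), fun _ => rfl⟩

end Subextension

/-! ### Comparison of the two rank functions -/

section Comparison

variable {K E R : Type*} [Field K] [Field E] [Algebra K E] [Ring R] [Algebra K R] {n m : ℕ}

theorem mul_tensorInclusion_mem (E₀ : IntermediateField K E) (U : Submodule E₀ E)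
    {k : ℕ} (u : Module.Basis (Fin k) E₀ U) {x : E ⊗[K] R}
    (hx : x ∈ tensorSubmodule R (U.restrictScalars K)) (y : E₀ ⊗[K] R) :
    x * tensorInclusion R E₀ y ∈ tensorSubmodule R (U.restrictScalars K) := by
  obtain ⟨e, he⟩ := exists_equiv_tensorSubmodule R E₀ U u
  obtain ⟨z, hz⟩ := e.surjective ⟨x, hx⟩
  have hx' : x = e z := by rw [hz]
  convert (e fun a => z a * y).2 using 1
  rw [hx', he, he, Finset.sum_mul]
  simp only [tensorInclusion_mul, mul_assoc]

/-- Right multiplication by a matrix over `E₀ ⊗ R`, on row vectors over `E₀ ⊗ R`. -/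
noncomputable def tensorVecMul {E₀ : IntermediateField K E}
    (A₀ : Matrix (Fin n) (Fin m) (E₀ ⊗[K] R)) :
    (Fin n → E₀ ⊗[K] R) →ₗ[R] (Fin m → E₀ ⊗[K] R) :=
  (Matrix.vecMulLinear A₀).restrictScalars R

/-- If `U` is an `E₀`-space of dimension `k` and `A` comes from a matrix `A₀` over `E₀ ⊗ R`, then
right multiplication by `A` on `(U ⊗ R) ^ n` is the direct sum of `k` copies of right
multiplication by `A₀` on `(E₀ ⊗ R) ^ n`. -/
theorem linRank_rowMulMap_tensorSubmodule (rk : SylvesterMatrixRank R)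
    (E₀ : IntermediateField K E) (U : Submodule E₀ E) {k : ℕ} (u : Module.Basis (Fin k) E₀ U)
    {A : Matrix (Fin n) (Fin m) (E ⊗[K] R)} {A₀ : Matrix (Fin n) (Fin m) (E₀ ⊗[K] R)}
    (hA₀ : ∀ i j, A i j = tensorInclusion R E₀ (A₀ i j))
    (hA : ∀ i j, ∀ x ∈ tensorSubmodule R (U.restrictScalars K),
      x * A i j ∈ tensorSubmodule R (U.restrictScalars K))
    [Module.Free R (tensorSubmodule R (U.restrictScalars K))]
    [Module.Finite R (tensorSubmodule R (U.restrictScalars K))]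
    [Module.Free R (E₀ ⊗[K] R)] [Module.Finite R (E₀ ⊗[K] R)] :
    rk.linRank (rowMulMap _ _ A hA) = k * rk.linRank (tensorVecMul A₀) := by
  obtain ⟨e, he⟩ := exists_equiv_tensorSubmodule R E₀ U u
  -- the row vectors over `U ⊗ R`, as families of `k` row vectors over `E₀ ⊗ R`
  let E' : ∀ d : ℕ, (Fin k → Fin d → E₀ ⊗[K] R) ≃ₗ[R]
      (Fin d → tensorSubmodule R (U.restrictScalars K)) := fun d =>
    { toFun := fun x i => e fun a => x a i
      map_add' := fun x y => funext fun i => map_add e (fun a => x a i) fun a => y a i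
      map_smul' := fun r x => funext fun i => map_smul e r fun a => x a i
      invFun := fun y a i => e.symm (y i) a
      left_inv := fun x => by simp
      right_inv := fun y => by simp }
  have hE : ∀ d x i, (E' d x i : E ⊗[K] R) =
      ∑ a, ((u a : E) ⊗ₜ[K] (1 : R)) * tensorInclusion R E₀ (x a i) := fun d x i => he _
  rw [← rk.linRank_compLeft]
  refine (rk.linRank_eq_of_equiv (E' n) (E' m) _ _ fun x => ?_).symm
  funext j
  ext
  have hR : (rowMulMap _ _ A hA (E' n x) j : E ⊗[K] R) = ∑ i, (E' n x i : E ⊗[K] R) * A i j := rfl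
  have hL : ∀ a, (tensorVecMul A₀).compLeft (Fin k) x a j = ∑ i, x a i * A₀ i j := fun a => rfl
  rw [hR, hE]
  simp only [hL, hE, hA₀, map_sum, tensorInclusion_mul, Finset.mul_sum, Finset.sum_mul, mul_assoc]
  exact Finset.sum_comm

/-- Freeness and finiteness of `E₀ ⊗ R` hold for all finite `E₀`, but enter as part of the data,
since `linRank` needs them. -/
theorem isAlgebraicRankValue_iff (rk : SylvesterMatrixRank R)
    (A : Matrix (Fin n) (Fin m) (E ⊗[K] R)) (r : ℝ) :
    IsAlgebraicRankValue rk A r ↔ ∃ E₀ : IntermediateField K E, FiniteDimensional K E₀ ∧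
      ∃ (_ : Module.Free R (E₀ ⊗[K] R)) (_ : Module.Finite R (E₀ ⊗[K] R))
        (A₀ : Matrix (Fin n) (Fin m) (E₀ ⊗[K] R)),
        (∀ i j, A i j = tensorInclusion R E₀ (A₀ i j)) ∧
        r = rk.linRank (tensorVecMul A₀) / (Module.finrank K E₀ : ℝ) := by
  constructor
  · rintro ⟨E₀, hE₀, A₀, rfl, l, p, w, w', B, hB, rfl⟩
    obtain ⟨b⟩ := exists_basis_tensor K E₀ R
    refine ⟨E₀, hE₀, Module.Free.of_basis b, Module.Finite.of_basis b, A₀, fun _ _ => rfl, ?_⟩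
    have := Module.Free.of_basis b
    have := Module.Finite.of_basis b
    rw [(rowMatrix_eq_iff w w' (tensorVecMul A₀) B).2 hB, rk.rank_rowMatrix]
  · rintro ⟨E₀, hE₀, _, _, A₀, hA, rfl⟩
    refine ⟨E₀, hE₀, A₀, Matrix.ext hA, _, _, freeBasis R _, freeBasis R _,
      rowMatrix (freeBasis R _) (freeBasis R _) (tensorVecMul A₀), ?_, rfl⟩
    exact (rowMatrix_eq_iff _ _ (tensorVecMul A₀) _).1 rfl

theorem exists_isAlgebraicRankValue [Algebra.IsAlgebraic K E] (rk : SylvesterMatrixRank R)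
    (A : Matrix (Fin n) (Fin m) (E ⊗[K] R)) : ∃ r, IsAlgebraicRankValue rk A r := by
  obtain ⟨E₀, hE₀, hT⟩ := exists_intermediateField_subset_range
    (Set.finite_range fun p : Fin n × Fin m => A p.1 p.2)
  choose A₀ hA₀ using fun (i : Fin n) (j : Fin m) => hT ⟨(i, j), rfl⟩
  obtain ⟨b⟩ := exists_basis_tensor K E₀ R
  exact ⟨_, (isAlgebraicRankValue_iff rk A _).2 ⟨E₀, hE₀, Module.Free.of_basis b,
    Module.Finite.of_basis b, A₀, fun i j => (hA₀ i j).symm, rfl⟩⟩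

/-- A member of the system that is almost invariant under a `K`-basis `b ⊗ 1` of `E₀` is
almost a direct sum of copies of `E₀ ⊗ R`: it lies in `U ⊗ R` for the `E₀`-space `U` that it
generates, and the dimension of `U` is hardly larger. -/
theorem IsInvariantMember.exists_subspace (rk : SylvesterMatrixRank R)
    (E₀ : IntermediateField K E) {ι : Type*} (b : Module.Basis ι K E₀) {ε : ℝ}
    {W : NonzeroMembers (tensorSystem K E R)}
    (hW : IsInvariantMember (tensorSystem K E R)
      (Set.range fun i => (b i : E) ⊗ₜ[K] (1 : R)) ε W) :
    ∃ U : Submodule E₀ E, FiniteDimensional K (U.restrictScalars K) ∧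
      W.1 ≤ tensorSubmodule R (U.restrictScalars K) ∧
      (freeDim R (tensorSubmodule R (U.restrictScalars K)) : ℝ) ≤ (1 + ε) * freeDim R W.1 := by
  have := rk.nontrivial
  have hF : IsFiniteApproximationSystem (tensorSystem K E R) :=
    isFiniteApproximationSystem_tensorSystem
  obtain ⟨V, hV, hVW⟩ := W.2.1
  replace hVW : W.1 = tensorSubmodule R V := hVW
  obtain ⟨_, ⟨V', hV', rfl⟩, hle, hmul, hdim⟩ := hW
  replace hmul : ∀ v ∈ V, ∀ i, v * (b i : E) ∈ V' := by
    intro v hv i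
    have h := hmul (v ⊗ₜ[K] (1 : R)) (hVW ▸ tmul_mem_tensorSubmodule hv 1) _ ⟨i, rfl⟩
    rw [Algebra.TensorProduct.tmul_mul_tmul, one_mul] at h
    exact tmul_one_mem_tensorSubmodule_iff.1 h
  have hsmul : ∀ v ∈ V, ∀ e : E₀, e • v ∈ V' := by
    intro v hv e
    induction b.mem_span e using Submodule.span_induction with
    | mem e he =>
      obtain ⟨i, rfl⟩ := he
      rw [IntermediateField.smul_def, smul_eq_mul, mul_comm]
      exact hmul v hv i
    | zero => rw [zero_smul]; exact zero_mem _
    | add x y _ _ hx hy => rw [add_smul]; exact add_mem hx hy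
    | smul c x _ hx => rw [smul_assoc]; exact V'.smul_mem c hx
  -- `U` is spanned by products of scalars in `E₀` with elements of `V`, as an additive group
  have hUV' : (Submodule.span E₀ (V : Set E)).restrictScalars K ≤ V' := by
    intro x hx
    refine Submodule.closure_induction (p := fun x _ => x ∈ V') ?_ ?_ ?_ hx
    · exact zero_mem _
    · exact fun x y _ _ hx hy => add_mem hx hy
    · exact fun e v hv => hsmul v hv e
  have hfin : FiniteDimensional K ((Submodule.span E₀ (V : Set E)).restrictScalars K) :=
    Submodule.finiteDimensional_of_le hUV'
  refine ⟨_, hfin, hVW ▸ tensorSubmodule_mono Submodule.subset_span, le_trans ?_ hdim⟩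
  exact_mod_cast hF.freeDim_mono rk ⟨_, hfin, rfl⟩ ⟨V', hV', rfl⟩ (tensorSubmodule_mono hUV')

/-- Every value of the extension of `rk` to `E ⊗ R` is the limit of `rk_W(A) / dim W`, whatever
the subextension it is computed from. In particular there is only one value. -/
theorem IsAlgebraicRankValue.tendsto {rk : SylvesterMatrixRank R}
    {A : Matrix (Fin n) (Fin m) (E ⊗[K] R)} {α : ℝ} (hα : IsAlgebraicRankValue rk A α)
    {ω : Ultrafilter (NonzeroMembers (tensorSystem K E R))}
    (hω : IsNonprincipal (tensorSystem K E R) ω) :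
    Tendsto (fun W : NonzeroMembers (tensorSystem K E R) =>
      localRank rk (tensorSystem K E R) W A / (freeDim R W.1 : ℝ)) ω (𝓝 α) := by
  have := rk.nontrivial
  have hF : IsFiniteApproximationSystem (tensorSystem K E R) :=
    isFiniteApproximationSystem_tensorSystem
  obtain ⟨E₀, hE₀, _, _, A₀, hA₀, rfl⟩ := (isAlgebraicRankValue_iff rk A α).1 hα
  set α := rk.linRank (tensorVecMul A₀) / (Module.finrank K E₀ : ℝ) with hα_def
  have hα0 : 0 ≤ α := div_nonneg (rk.linRank_nonneg _) (Nat.cast_nonneg _)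
  have hE0 : (0 : ℝ) < Module.finrank K E₀ := by exact_mod_cast Module.finrank_pos
  rw [Metric.tendsto_nhds]
  intro δ hδ
  -- an `ε`-invariant `W` has `-n ε ≤ rk_W(A) / dim W - α ≤ α ε`; the summand `1` keeps the
  -- divisor of `δ` positive and the inequalities strict
  have hc : 0 < α + n + 1 := by positivity
  have hε : 0 < δ / (α + n + 1) := div_pos hδ hc
  have v := Module.finBasis K E₀
  filter_upwards [hω _ (Set.finite_range fun i => (v i : E) ⊗ₜ[K] (1 : R)) _ hε] with W hW
  obtain ⟨U, hUfin, hWU, hdim⟩ := IsInvariantMember.exists_subspace rk E₀ v hW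
  set ε := δ / (α + n + 1)
  have hmem : tensorSubmodule R (U.restrictScalars K) ∈ tensorSystem K E R := ⟨_, hUfin, rfl⟩
  have := hF.moduleFree hmem
  have := hF.moduleFinite hmem
  have := hF.moduleFree W.2.1
  have := hF.moduleFinite W.2.1
  have hUK : Module.Finite K U := hUfin
  have hU0 : FiniteDimensional E₀ U := Module.Finite.of_restrictScalars_finite K E₀ U
  have hUfree : Module.Free E₀ U := Module.Free.of_divisionRing E₀ U
  have u := Module.finBasis E₀ U
  have hA : ∀ i j, ∀ x ∈ tensorSubmodule R (U.restrictScalars K),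
      x * A i j ∈ tensorSubmodule R (U.restrictScalars K) := by
    intro i j x hx
    rw [hA₀]
    exact mul_tensorInclusion_mem E₀ U u hx _
  obtain ⟨h₁, h₂⟩ := localRank_bounds rk hF W hmem A hWU hA
  have hrank := linRank_rowMulMap_tensorSubmodule rk E₀ U u hA₀ hA
  -- `dim (U ⊗ R) = [U : E₀] [E₀ : K]`, so the rank on `(U ⊗ R) ^ n` is `dim (U ⊗ R) * α`
  obtain ⟨b⟩ := exists_basis_tensor K E₀ R
  obtain ⟨e, -⟩ := exists_equiv_tensorSubmodule R E₀ U u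
  have hdimU := rk.freeDim_congr e
  rw [rk.freeDim_pi, rk.freeDim_eq b] at hdimU
  have hrank' : rk.linRank (rowMulMap _ _ A hA) =
      freeDim R (tensorSubmodule R (U.restrictScalars K)) * α := by
    rw [hrank, ← hdimU, hα_def]
    push_cast
    field_simp
  have hd : (0 : ℝ) < freeDim R W.1 := by
    exact_mod_cast hF.freeDim_pos rk W
  have hdD : (freeDim R W.1 : ℝ) ≤ freeDim R (tensorSubmodule R (U.restrictScalars K)) := by
    exact_mod_cast hF.freeDim_mono rk W.2.1 hmem hWU
  rw [hrank'] at h₁ h₂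
  generalize localRank rk (tensorSystem K E R) W A = x at *
  generalize (freeDim R W.1 : ℝ) = d at *
  generalize (freeDim R (tensorSubmodule R (U.restrictScalars K)) : ℝ) = D at *
  rw [Real.dist_eq, abs_lt, lt_sub_iff_add_lt, sub_lt_iff_lt_add, lt_div_iff₀ hd, div_lt_iff₀ hd]
  have hδε : δ = ε * (α + n + 1) := (div_mul_cancel₀ δ hc.ne').symm
  have hn : (n : ℝ) * (D - d) ≤ n * (ε * d) := by gcongr; linarith
  have hDα : D * α ≤ (1 + ε) * d * α := by gcongr
  have hdα : d * α ≤ D * α := by gcongr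
  have hεd : 0 < ε * d := mul_pos hε hd
  have hεdα : 0 ≤ ε * d * α := by positivity
  have hεdn : 0 ≤ ε * d * n := by positivity
  constructor
  · rw [hδε]
    linarith
  · rw [hδε]
    linarith

end Comparison

theorem proposition9p2 {K E R : Type*} [Field K] [Field E] [Algebra K E]
    [Algebra.IsAlgebraic K E] [Ring R] [Algebra K R] (rk : SylvesterMatrixRank R) :
    -- the objects are well defined
    IsRightAmenableExtension (tensorSystem K E R) ∧
    (∃ ω : Ultrafilter (NonzeroMembers (tensorSystem K E R)),
      IsNonprincipal (tensorSystem K E R) ω) ∧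
    (∀ (n m : ℕ) (A : Matrix (Fin n) (Fin m) (E ⊗[K] R))
      (W : NonzeroMembers (tensorSystem K E R)) (r : ℝ),
      IsLocalRankValue rk (tensorSystem K E R) W A r ↔
        r = localRank rk (tensorSystem K E R) W A) ∧
    (∀ (n m : ℕ) (A : Matrix (Fin n) (Fin m) (E ⊗[K] R)) (r : ℝ),
      IsAlgebraicRankValue rk A r ↔ r = algebraicRank rk A) ∧
    -- the limit defining `rk_F` exists, and it is Jaikin-Zapirain's extension
    ∀ ω : Ultrafilter (NonzeroMembers (tensorSystem K E R)),
      IsNonprincipal (tensorSystem K E R) ω →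
      ∀ (n m : ℕ) (A : Matrix (Fin n) (Fin m) (E ⊗[K] R)),
        Tendsto
          (fun W : NonzeroMembers (tensorSystem K E R) =>
            localRank rk (tensorSystem K E R) W A / (freeDim R W.1 : ℝ))
          (ω : Filter (NonzeroMembers (tensorSystem K E R)))
          (𝓝 (amenableRank rk (tensorSystem K E R) ω A)) ∧
        amenableRank rk (tensorSystem K E R) ω A = algebraicRank rk A := by
  have := rk.nontrivial
  have hS : IsRightAmenableExtension (tensorSystem K E R) := isRightAmenableExtension_tensorSystem
  have hex := hS.exists_isNonprincipal
  have hval : ∀ (n m : ℕ) (A : Matrix (Fin n) (Fin m) (E ⊗[K] R)),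
      IsAlgebraicRankValue rk A (algebraicRank rk A) := fun n m A =>
    Classical.epsilon_spec (exists_isAlgebraicRankValue rk A)
  refine ⟨hS, hex, fun n m A W r => isLocalRankValue_iff_eq_localRank rk
    hS.toIsFiniteApproximationSystem W A r, fun n m A r => ⟨fun hr => ?_, ?_⟩,
    fun ω hω n m A => ?_⟩
  · obtain ⟨ω, hω⟩ := hex
    exact tendsto_nhds_unique (hr.tendsto hω) ((hval n m A).tendsto hω)
  · rintro rfl
    exact hval n m A
  · have hlim := (hval n m A).tendsto hω
    have heq : amenableRank rk (tensorSystem K E R) ω A = algebraicRank rk A := hlim.limUnder_eq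
    exact ⟨heq ▸ hlim, heq⟩
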